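/- For a permutation $\pi$ of $\{1,\dots,n\}$, its standard cycle form is obtained by writing each cycle (fixed points included) with its smallest element first and listing the cycles in decreasing order of their smallest elements; $\mathrm{cyc}(\pi)$ is the number of cycles. A cyclic occurrence of the consecutive pattern $123$ in $\pi$ consists of three letters $a<b<c$ that appear in this order in three consecutive positions of the word obtained from the standard cycle form by deleting the parentheses, where the last letter of a cycle and the first letter of the next cycle do not count as consecutive. Let $f_{123}(k,m,n)$ be the number of permutations of $\{1,\dots,n\}$ with $m$ cycles and $k$ cyclic occurrences of $123$, let $g_{123}(k,n)$ be the number of permutations $\pi$ of $\{1,\dots,n\}$ with exactly $k$ indices $i$ such that $\pi(i)<\pi(i+1)<\pi(i+2)$, and put $$F_{123}(q,x,z)=\sum_{k,m,n\ge 0}f_{123}(k,m,n)\,q^kx^mz^n,\qquad G_{123}(q,z)=\sum_{k,n\ge 0}g_{123}(k,n)\,q^kz^n .$$ These are formal power series in $z$ over the polynomial ring $\mathbb{Z}[q,x]$, or, more generally, over any commutative ring $A$ containing chosen elements $q,x$. A bicoloured Motzkin path of length $n$ is a lattice path from $(0,0)$ to $(n,0)$ with steps $\mathrm N=(1,1)$,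 $\mathrm S=(1,-1)$ and two colours $\mathrm E,\mathrm F$ of the step $(1,0)$, which never goes below height $0$. Given $N_h,S_h,E_h,F_h\in A$ for $h\ge 0$, the weight $w(p)$ of a path $p$ is the product of the weights of its steps, a step $\mathrm N,\mathrm S,\mathrm E,\mathrm F$ that starts at height $h$ having weight $N_h,S_h,E_h,F_h$, respectively. Then: 1. For all weights $N_h,S_h,E_h,F_h$ with $E_h+F_h=h(1+q)+x$ and $N_hS_{h+1}=(h+1)(h+x)$ for every $h\ge 0$, $$F_{123}(q,x,z)=\sum_{n\ge 0}\ \sum_{p}w(p)\,z^n,$$ where $p$ runs over the bicoloured Motzkin paths of length $n$. 2. As formal power series in $z$ (the convergents converge coefficientwise), $$F_{123}(q,x,z)=\cfrac{1}{1-xz-\cfrac{x z^2}{1-(1+q+x)z-\cfrac{2(1+x)z^2}{1-(2+2q+x)z-\cfrac{3(2+x)z^2}{1-(3+3q+x)z-\cdots}}}},$$ that is, the coefficient of $z$ at level $h$ is $h(1+q)+x$ and the numerator following it is $(h+1)(h+x)z^2$, for $h=0,1,2,\dots$. 3. $F_{123}(q,1,z)=G_{123}(q,z)$. -/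

import Mathlib

noncomputable section

namespace CycPat

/-! ### Permutations in standard cycle form

The set `{1, …, n}` is represented by the ordered set `Fin n`. -/

/-- `i` is the smallest element of the cycle of `π` that contains it. -/
def IsCycleMin {n : ℕ} (π : Equiv.Perm (Fin n)) (i : Fin n) : Prop :=
  ∀ j, π.SameCycle i j → i ≤ j

/-- The cycle of `π` through `i`, written as a word that starts with `i`:
`i, π i, π (π i), …`, each element of the cycle once (`[i]` if `i` is a fixed point). -/
def cycleWord {n : ℕ} (π : Equiv.Perm (Fin n)) (i : Fin n) : List (Fin n) :=
  List.iterate π i (Function.minimalPeriod π i)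

open Classical in
/-- The standard cycle form of `π`: the list of its cycles (fixed points included), each written
with its smallest element first, in decreasing order of their smallest elements. -/
def stdCycleForm {n : ℕ} (π : Equiv.Perm (Fin n)) : List (List (Fin n)) :=
  ((List.finRange n).reverse.filter (fun i => decide (IsCycleMin π i))).map (cycleWord π)

/-- The number of cycles of `π`. -/
def cyc {n : ℕ} (π : Equiv.Perm (Fin n)) : ℕ := (stdCycleForm π).length

/-- `Ψ(π)`: the word (one-line notation) obtained from the standard cycle form by removing the
parentheses. -/
def psi {n : ℕ} (π : Equiv.Perm (Fin n)) : List (Fin n) := (stdCycleForm π).flatten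

/-- Position `i` of `Ψ(π)` (positions are numbered from `0`) holds the last letter of one of the
cycles of the standard cycle form, i.e. the first `j` cycles end at position `i` for some `j`. -/
def IsCycleEnd {n : ℕ} (π : Equiv.Perm (Fin n)) (i : ℕ) : Prop :=
  ∃ j, i + 1 = ((stdCycleForm π).take j).flatten.length

/-! ### Occurrences of the consecutive pattern 123 -/

/-- The consecutive pattern 123 occurs in the word `w` at position `i`. -/
def Occurs123 {n : ℕ} (w : List (Fin n)) (i : ℕ) : Prop :=
  ∃ h : i + 2 < w.length, w[i] < w[i + 1] ∧ w[i + 1] < w[i + 2]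

open Classical in
/-- The number of (classical, non-cyclic) occurrences of 123 in `π = π(1) ⋯ π(n)`. -/
def occ123 {n : ℕ} (π : Equiv.Perm (Fin n)) : ℕ :=
  ((Finset.range n).filter (fun i => Occurs123 (List.ofFn π) i)).card

open Classical in
/-- The number of cyclic occurrences of 123 in `π`: occurrences of 123 in `Ψ(π)` in which no last
letter of a cycle is regarded as adjacent to the first letter of the next cycle. -/
def cocc123 {n : ℕ} (π : Equiv.Perm (Fin n)) : ℕ :=
  ((Finset.range n).filter
    (fun i => Occurs123 (psi π) i ∧ ¬ IsCycleEnd π i ∧ ¬ IsCycleEnd π (i + 1))).card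

open Classical in
/-- The number of permutations of length `n` with `m` cycles and `k` cyclic occurrences of 123. -/
def f123 (k m n : ℕ) : ℕ :=
  (Finset.univ.filter (fun π : Equiv.Perm (Fin n) => cocc123 π = k ∧ cyc π = m)).card

open Classical in
/-- The number of permutations of length `n` with `k` classical occurrences of 123. -/
def g123 (k n : ℕ) : ℕ :=
  (Finset.univ.filter (fun π : Equiv.Perm (Fin n) => occ123 π = k)).card

/-! ### The generating functions

They are power series in `z` whose coefficients are polynomials in `q`, `x`; here `q`, `x` may be
any elements of a commutative ring (for instance the two variables of `ℤ[q, x]`). -/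

/-- `F₁₂₃(q, x, z) = ∑ f₁₂₃(k, m, n) q ^ k x ^ m z ^ n`. The terms with `k > n` or `m > n` vanish;
see `coeff_F123`. -/
def F123 {A : Type*} [CommRing A] (q x : A) : PowerSeries A :=
  PowerSeries.mk fun n =>
    ∑ k ∈ Finset.range (n + 1), ∑ m ∈ Finset.range (n + 1), (f123 k m n : A) * q ^ k * x ^ m

/-- `G₁₂₃(q, z) = ∑ g₁₂₃(k, n) q ^ k z ^ n`. The terms with `k > n` vanish; see `coeff_G123`. -/
def G123 {A : Type*} [CommRing A] (q : A) : PowerSeries A :=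
  PowerSeries.mk fun n => ∑ k ∈ Finset.range (n + 1), (g123 k n : A) * q ^ k

theorem occ123_le {n : ℕ} (π : Equiv.Perm (Fin n)) : occ123 π ≤ n := by
  classical
  exact (Finset.card_filter_le _ _).trans (Finset.card_range n).le

theorem cocc123_le {n : ℕ} (π : Equiv.Perm (Fin n)) : cocc123 π ≤ n := by
  classical
  exact (Finset.card_filter_le _ _).trans (Finset.card_range n).le

theorem cyc_le {n : ℕ} (π : Equiv.Perm (Fin n)) : cyc π ≤ n := by
  unfold cyc stdCycleForm
  rw [List.length_map]
  exact (List.length_filter_le _ _).trans (by simp)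

theorem coeff_G123 {A : Type*} [CommRing A] (q : A) (n : ℕ) :
    PowerSeries.coeff n (G123 q) = ∑ π : Equiv.Perm (Fin n), q ^ occ123 π := by
  classical
  rw [G123, PowerSeries.coeff_mk, ← Finset.sum_fiberwise_of_maps_to
    (s := Finset.univ) (t := Finset.range (n + 1)) (g := fun π : Equiv.Perm (Fin n) => occ123 π)
    (fun π _ => Finset.mem_range.2 (Nat.lt_succ_of_le (occ123_le π)))]
  refine Finset.sum_congr rfl fun k _ => ?_
  rw [Finset.sum_congr rfl (g := fun _ => q ^ k)
    (fun π hπ => by rw [(Finset.mem_filter.1 hπ).2]), Finset.sum_const, nsmul_eq_mul, g123]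

theorem coeff_F123 {A : Type*} [CommRing A] (q x : A) (n : ℕ) :
    PowerSeries.coeff n (F123 q x) =
      ∑ π : Equiv.Perm (Fin n), q ^ cocc123 π * x ^ cyc π := by
  classical
  rw [F123, PowerSeries.coeff_mk, ← Finset.sum_product', ← Finset.sum_fiberwise_of_maps_to
    (s := Finset.univ) (t := Finset.range (n + 1) ×ˢ Finset.range (n + 1))
    (g := fun π : Equiv.Perm (Fin n) => (cocc123 π, cyc π))
    (fun π _ => Finset.mem_product.2 ⟨Finset.mem_range.2 (Nat.lt_succ_of_le (cocc123_le π)),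
      Finset.mem_range.2 (Nat.lt_succ_of_le (cyc_le π))⟩)]
  refine Finset.sum_congr rfl fun km _ => ?_
  rw [Finset.sum_congr rfl (g := fun _ => q ^ km.1 * x ^ km.2)
    (fun π hπ => by rw [← (Finset.mem_filter.1 hπ).2]), Finset.sum_const, nsmul_eq_mul, f123,
    mul_assoc]
  congr! 4
  rw [Prod.ext_iff]

/-! ### Bicoloured Motzkin paths -/

/-- Steps: `N = (1, 1)`, `S = (1, -1)`, and the two colours `E`, `F` of `(1, 0)`. -/
inductive Step
  | N | S | E | F
  deriving DecidableEq

instance : Fintype Step where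
  elems := {.N, .S, .E, .F}
  complete := by intro s; cases s <;> simp

/-- The vertical displacement of a step. -/
def Step.rise : Step → ℤ
  | .N => 1
  | .S => -1
  | .E => 0
  | .F => 0

/-- The height of the `i`-th vertex of the lattice path from `(0, 0)` with steps `s`. -/
def height {n : ℕ} (s : Fin n → Step) (i : ℕ) : ℤ :=
  ∑ j ∈ Finset.univ.filter (fun j : Fin n => (j : ℕ) < i), (s j).rise

/-- The path with steps `s` is a Motzkin path: it never goes below height `0` and ends at
height `0`. -/
def IsMotzkin {n : ℕ} (s : Fin n → Step) : Prop :=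
  (∀ i ≤ n, 0 ≤ height s i) ∧ height s n = 0

section Weights

variable {A : Type*} [CommRing A]

/-- The weight of a step that starts at height `h`, given `N_h`, `S_h`, `E_h`, `F_h`. -/
def stepWeight (N S E F : ℕ → A) : Step → ℕ → A
  | .N, h => N h
  | .S, h => S h
  | .E, h => E h
  | .F, h => F h

/-- The weight of a path is the product of the weights of its steps. -/
def pathWeight (N S E F : ℕ → A) {n : ℕ} (s : Fin n → Step) : A :=
  ∏ i : Fin n, stepWeight N S E F (s i) (height s i).toNat

open Classical in
/-- The generating function `∑_n ∑_p w(p) z ^ n` of weighted bicoloured Motzkin paths, `p` running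
over the paths of length `n`. -/
def motzkinGF (N S E F : ℕ → A) : PowerSeries A :=
  PowerSeries.mk fun n =>
    ∑ s ∈ Finset.univ.filter (fun s : Fin n → Step => IsMotzkin s), pathWeight N S E F s

/-! ### J-fractions -/

/-- The finite continued fraction with `k + 1` levels, starting from level `h`,
`1 / (1 - b_h z - c_h z² / (1 - b_{h+1} z - ⋯ - c_{h+k-1} z² / (1 - b_{h+k} z)))`.
Every denominator has constant term `1`, so that `invOfUnit _ 1` is its inverse. -/
def jConvergent (b c : ℕ → A) : ℕ → ℕ → PowerSeries A
  | 0, h => PowerSeries.invOfUnit (1 - PowerSeries.C (b h) * PowerSeries.X) 1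
  | k + 1, h => PowerSeries.invOfUnit
      (1 - PowerSeries.C (b h) * PowerSeries.X
        - PowerSeries.C (c h) * PowerSeries.X ^ 2 * jConvergent b c k (h + 1)) 1

/-- `f = 1 / (1 - b_0 z - c_0 z² / (1 - b_1 z - c_1 z² / (1 - b_2 z - ⋯)))` as formal power
series: every coefficient of the convergents is eventually equal to that of `f`. -/
def HasJFraction (f : PowerSeries A) (b c : ℕ → A) : Prop :=
  ∀ n, ∀ᶠ k in Filter.atTop, PowerSeries.coeff n (jConvergent b c k 0) = PowerSeries.coeff n f

end Weights

end CycPat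

end

noncomputable section

namespace CycPat

/-! ### The tridiagonal recurrence -/

section Tridiagonal

variable {A : Type*} [CommRing A]

/-! All three statements reduce to one sequence, `tridiag b c n 0` with b_h = h(1+q)+x and c_h =
(h+1)(h+x), and to a description of cyclic occurrences by local types of letters.

In a standard cycle form, the step that closes a cycle returns to its minimum, and the step from one
block to the next goes down to a smaller head. Hence every ascent of the word lies inside a block
and is an ascent a < π a, and conversely. Cyclic occurrences of 123 are therefore the ordinary
occurrences in `psi π`, and they correspond to the letters i with π⁻¹ i < i < π i
(`cocc123_eq_card`). Since `psi` is a bijection onto one-line words (the blocks are recovered from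
the word, `eq_of_flatten_eq`), setting x = 1 gives G.

For the recurrence, give double ascents the weight q, double descents and fixed points r, peaks u,
valleys 1. Inserting a new maximum into an arc of a cycle creates a peak and changes exactly one old
letter: q → 1, r → 1, and u → r or u → q, according to the arc. So all insertions together act as
u·D, where D is the derivation with Dq = Dr = 1, Du = q+r; a new fixed point contributes x·r. The
enumerators satisfy P_{n+1} = x r P_n + u D P_n (`permEnum_succ`). Because D²u = 2 and D³u = 0,
applying D^h with the Leibniz rule involves only D^{h+1}P_n, D^hP_n and D^{h-1}P_n
(`insDer_iterate`). At r = u = 1 this is the tridiagonal recurrence, the height h being the number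
of derivatives.

Weighted Motzkin paths obey the same recurrence by removing the first step, and so, up to
truncation, do products of convergents (`coeff_jProd`). -/

/-- The solution of the tridiagonal recurrence with diagonal `b`, upper diagonal `1` and lower
diagonal `c`: the generating polynomial of Motzkin paths from height `h` to height `0`. -/
def tridiag (b c : ℕ → A) : ℕ → ℕ → A
  | 0, 0 => 1
  | 0, _ + 1 => 0
  | n + 1, 0 => tridiag b c n 1 + b 0 * tridiag b c n 0
  | n + 1, h + 1 =>
    tridiag b c n (h + 2) + b (h + 1) * tridiag b c n (h + 1) + c h * tridiag b c n h

/-! ### Motzkin paths -/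

theorem height_zero {n : ℕ} (s : Fin n → Step) : height s 0 = 0 := by
  simp [height]

theorem height_cons {n : ℕ} (a : Step) (t : Fin n → Step) (i : ℕ) :
    height (Fin.cons a t : Fin (n + 1) → Step) (i + 1) = a.rise + height t i := by
  simp only [height, Finset.sum_filter, Fin.sum_univ_succ]
  simp

/-- The path with steps `s`, started at height `h`, stays nonnegative and ends at height `0`. -/
def IsMotzkinFrom {n : ℕ} (h : ℤ) (s : Fin n → Step) : Prop :=
  (∀ i ≤ n, 0 ≤ h + height s i) ∧ h + height s n = 0

theorem isMotzkinFrom_cons {n : ℕ} (h : ℤ) (a : Step) (t : Fin n → Step) :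
    IsMotzkinFrom h (Fin.cons a t : Fin (n + 1) → Step) ↔
      0 ≤ h ∧ IsMotzkinFrom (h + a.rise) t := by
  unfold IsMotzkinFrom
  rw [height_cons, ← add_assoc, ← and_assoc]
  refine and_congr_left fun _ => ⟨fun H => ⟨?_, fun i hi => ?_⟩, fun ⟨h0, H⟩ i hi => ?_⟩
  · simpa [height_zero] using H 0 (Nat.zero_le _)
  · have := H (i + 1) (Nat.succ_le_succ hi)
    rwa [height_cons, ← add_assoc] at this
  · cases i with
    | zero => simpa [height_zero] using h0
    | succ i =>
      rw [height_cons, ← add_assoc]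
      exact H i (Nat.le_of_succ_le_succ hi)

open Classical in
/-- The weighted sum over the paths of length `n` from height `h` to height `0`. -/
def pathSum (N S E F : ℕ → A) (n : ℕ) (h : ℤ) : A :=
  ∑ s : Fin n → Step, if IsMotzkinFrom h s then
    ∏ i : Fin n, stepWeight N S E F (s i) (h + height s i).toNat else 0

theorem pathSum_zero (N S E F : ℕ → A) (h : ℕ) :
    pathSum N S E F 0 h = if h = 0 then 1 else 0 := by
  simp [pathSum, IsMotzkinFrom, height]

/-- Disposes of a down step from height 0, so that `pathSum_succ` needs no boundary case. -/
theorem pathSum_neg_one (N S E F : ℕ → A) (n : ℕ) : pathSum N S E F n (-1) = 0 := by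
  refine Finset.sum_eq_zero fun s _ => if_neg fun H => ?_
  simpa [height_zero] using H.1 0 (Nat.zero_le _)

theorem pathSum_succ (N S E F : ℕ → A) (n h : ℕ) :
    pathSum N S E F (n + 1) h = N h * pathSum N S E F n (h + 1 : ℕ)
      + S h * pathSum N S E F n (h - 1) + (E h + F h) * pathSum N S E F n h := by
  classical
  have key : pathSum N S E F (n + 1) h
      = ∑ a : Step, stepWeight N S E F a h * pathSum N S E F n (h + a.rise) := by
    simp only [pathSum]
    -- Split off the first step; the rest is a path started at the new height.
    rw [← (Fin.consEquiv fun _ => Step).sum_comp, Fintype.sum_prod_type]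
    refine Finset.sum_congr rfl fun a _ => ?_
    rw [Finset.mul_sum]
    refine Finset.sum_congr rfl fun t _ => ?_
    change (if IsMotzkinFrom (h : ℤ) (Fin.cons a t : Fin (n + 1) → Step) then
      ∏ i, stepWeight N S E F ((Fin.cons a t : Fin (n + 1) → Step) i)
        ((h : ℤ) + height (Fin.cons a t : Fin (n + 1) → Step) i).toNat else 0) = _
    simp only [isMotzkinFrom_cons, Int.natCast_nonneg, true_and, mul_ite,
      mul_zero, Fin.prod_univ_succ, Fin.cons_zero, Fin.cons_succ, Fin.val_succ, height_cons,
      Fin.val_zero, height_zero, add_zero, Int.toNat_natCast, add_assoc]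
  rw [key]
  have hu : (Finset.univ : Finset Step) = {.N, .S, .E, .F} := rfl
  rw [hu, Finset.sum_insert (by decide), Finset.sum_insert (by decide),
    Finset.sum_insert (by decide), Finset.sum_singleton]
  simp only [stepWeight, Step.rise, add_zero, ← sub_eq_add_neg, Nat.cast_add, Nat.cast_one]
  ring

/-- The prefactor supplies an up step N_i for each unmatched down step S_{i+1} of a path from h to
0. Then N and S enter only through the products N_i S_{i+1}, and no division is needed. -/
theorem prod_mul_pathSum {N S E F b c : ℕ → A} (hb : ∀ h, E h + F h = b h)
    (hc : ∀ h, N h * S (h + 1) = c h) (n h : ℕ) :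
    (∏ i ∈ Finset.range h, N i) * pathSum N S E F n h = tridiag b c n h := by
  induction n generalizing h with
  | zero => cases h <;> rw [pathSum_zero] <;> simp [tridiag]
  | succ n ih =>
    rw [pathSum_succ, hb]
    cases h with
    | zero =>
      rw [tridiag, ← ih 1, ← ih 0]
      simp [pathSum_neg_one]
    | succ h =>
      rw [tridiag, ← ih (h + 2), ← ih (h + 1), ← ih h, ← hc h]
      have : ((h + 1 : ℕ) : ℤ) - 1 = h := by simp
      rw [this]
      simp only [Finset.prod_range_succ]
      ring

theorem coeff_motzkinGF {N S E F b c : ℕ → A} (hb : ∀ h, E h + F h = b h)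
    (hc : ∀ h, N h * S (h + 1) = c h) (n : ℕ) :
    PowerSeries.coeff n (motzkinGF N S E F) = tridiag b c n 0 := by
  classical
  rw [← prod_mul_pathSum hb hc, motzkinGF, PowerSeries.coeff_mk, Finset.sum_filter]
  have h0 : ∀ s : Fin n → Step, IsMotzkinFrom 0 s ↔ IsMotzkin s := fun s => by
    simp [IsMotzkinFrom, IsMotzkin]
  simp only [pathSum, h0, pathWeight, Finset.prod_range_zero, one_mul, Nat.cast_zero, zero_add]

/-! ### Convergents -/

theorem jConvergent_succ_mul (b c : ℕ → A) (k h : ℕ) :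
    (1 - PowerSeries.C (b h) * PowerSeries.X
        - PowerSeries.C (c h) * PowerSeries.X ^ 2 * jConvergent b c k (h + 1))
      * jConvergent b c (k + 1) h = 1 :=
  PowerSeries.mul_invOfUnit _ _ (by simp)

/-- The truncated generating function of Motzkin paths from height `h` to height `0`. -/
def jProd (b c : ℕ → A) (K h : ℕ) : PowerSeries A :=
  (∏ i ∈ Finset.range h, PowerSeries.C (c i) * PowerSeries.X) *
    ∏ i ∈ Finset.range (h + 1), jConvergent b c (K - i) i

theorem jProd_zero (b c : ℕ → A) (K : ℕ) :
    jProd b c (K + 1) 0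
      = 1 + PowerSeries.X * (jProd b c (K + 1) 1 + PowerSeries.C (b 0) * jProd b c (K + 1) 0) := by
  have := jConvergent_succ_mul b c K 0
  simp only [jProd, Finset.prod_range_succ, Finset.prod_range_zero, Nat.sub_zero, one_mul,
    Nat.add_sub_cancel]
  linear_combination this

/-- The depth K - i at level i makes the convergent there contain exactly the one used at level i +
1. The defining equation of the former, times the remaining factors, is the recurrence. -/
theorem jProd_succ (b c : ℕ → A) (K h : ℕ) (hK : h + 1 < K) :
    jProd b c K (h + 1)
      = PowerSeries.X * (jProd b c K (h + 2) + PowerSeries.C (b (h + 1)) * jProd b c K (h + 1)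
        + PowerSeries.C (c h) * jProd b c K h) := by
  obtain ⟨k, rfl⟩ := Nat.exists_eq_add_of_lt hK
  have := jConvergent_succ_mul b c k (h + 1)
  have e1 : h + 1 + k + 1 - (h + 1) = k + 1 := by omega
  have e2 : h + 1 + k + 1 - (h + 2) = k := by omega
  simp only [jProd, Finset.prod_range_succ _ (h + 2), Finset.prod_range_succ _ (h + 1),
    Finset.prod_range_succ _ h, e1, e2]
  generalize ∏ i ∈ Finset.range h, PowerSeries.C (c i) * PowerSeries.X = P
  generalize ∏ i ∈ Finset.range h, jConvergent b c (h + 1 + k + 1 - i) i = Q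
  linear_combination P * Q * (PowerSeries.C (c h) * PowerSeries.X) *
    jConvergent b c (h + 1 + k + 1 - h) h * this

/-- Each use of the recurrence lowers n by one and raises h by at most one, so n + h < K keeps the
induction away from the truncation level. -/
theorem coeff_jProd (b c : ℕ → A) (K n h : ℕ) (hK : n + h < K) :
    PowerSeries.coeff n (jProd b c K h) = tridiag b c n h := by
  induction n generalizing h with
  | zero =>
    cases h with
    | zero =>
      obtain ⟨K, rfl⟩ := Nat.exists_eq_succ_of_ne_zero (by omega : K ≠ 0)
      rw [jProd_zero]
      simp [tridiag]
    | succ h =>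
      rw [jProd_succ b c K h (by omega)]
      simp [tridiag]
  | succ n ih =>
    cases h with
    | zero =>
      obtain ⟨K, rfl⟩ := Nat.exists_eq_succ_of_ne_zero (by omega : K ≠ 0)
      rw [jProd_zero, tridiag, ← ih 1 (by omega), ← ih 0 (by omega)]
      simp [PowerSeries.coeff_succ_X_mul, PowerSeries.coeff_one]
    | succ h =>
      rw [jProd_succ b c K h (by omega), tridiag, ← ih (h + 2) (by omega),
        ← ih (h + 1) (by omega), ← ih h (by omega)]
      simp [PowerSeries.coeff_succ_X_mul]

theorem hasJFraction_of_coeff_eq_tridiag {f : PowerSeries A} {b c : ℕ → A}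
    (hf : ∀ n, PowerSeries.coeff n f = tridiag b c n 0) : HasJFraction f b c := by
  intro n
  filter_upwards [Filter.eventually_gt_atTop n] with K hK
  rw [hf, ← coeff_jProd b c K n 0 hK]
  simp [jProd]

end Tridiagonal

end CycPat

namespace CycPat
open MvPolynomial

/-! ### The weight of a permutation by the local types of its letters -/

section Weight

variable {A : Type*} [CommRing A]

/-- The derivation of `A[q, r, u]` with `q, r ↦ 1` and `u ↦ q + r`. -/
def insDer (A : Type*) [CommRing A] :
    Derivation A (MvPolynomial (Fin 3) A) (MvPolynomial (Fin 3) A) :=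
  mkDerivation A ![1, 1, X 0 + X 1]

theorem insDer_X0 : insDer A (X 0) = 1 := by simp [insDer, mkDerivation_X]
theorem insDer_X1 : insDer A (X 1) = 1 := by simp [insDer, mkDerivation_X]
theorem insDer_X2 : insDer A (X 2) = X 0 + X 1 := by simp [insDer, mkDerivation_X]

/-- The weight of a letter, given whether its predecessor in its cycle is smaller and whether its
successor is larger: `q` for double ascents, `r` for double descents (and fixed points), `u` for
peaks, `1` for valleys. -/
def letterWeight : Bool → Bool → MvPolynomial (Fin 3) A
  | true, true => X 0
  | false, false => X 1
  | true, false => X 2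
  | false, true => 1

theorem insDer_letterWeight (α β : Bool) :
    insDer A (letterWeight α β) =
      (if α = true then letterWeight false β else 0)
        + if β = false then letterWeight α true else 0 := by
  cases α <;> cases β <;>
    simp [letterWeight, insDer_X0, insDer_X1, insDer_X2, add_comm]

theorem derivation_prod {R B : Type*} [CommRing R] [CommRing B] [Algebra R B] {ι : Type*}
    [DecidableEq ι] (D : Derivation R B B) (s : Finset ι) (f : ι → B) :
    D (∏ i ∈ s, f i) = ∑ i ∈ s, (∏ j ∈ s.erase i, f j) * D (f i) := by
  induction s using Finset.induction_on with
  | empty => simp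
  | insert a s ha ih =>
    rw [Finset.prod_insert ha, D.leibniz, ih, Finset.sum_insert ha, Finset.erase_insert ha,
      add_comm, smul_eq_mul, smul_eq_mul, Finset.mul_sum]
    congr 1
    refine Finset.sum_congr rfl fun i hi => ?_
    have hne : a ≠ i := fun h => ha (h ▸ hi)
    rw [Finset.erase_insert_of_ne hne, Finset.prod_insert (by simp [ha]), mul_assoc]

/-- If `α` and `β` record the ascents into and out of each letter, the insertions of a new
maximum act on the weight as the derivation `insDer`. -/
theorem sum_prod_letterWeight {ι : Type*} [Fintype ι] [DecidableEq ι] (σ : Equiv.Perm ι)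
    (α β : ι → Bool) (h : ∀ i, α (σ i) = β i) :
    ∑ j, ∏ i, letterWeight (A := A) (!decide (i = j) && α i) (decide (σ i = j) || β i)
      = insDer A (∏ i, letterWeight (α i) (β i)) := by
  have hterm : ∀ j, ∏ i, letterWeight (A := A) (!decide (i = j) && α i) (decide (σ i = j) || β i)
      = (if α j = true then
          (∏ i ∈ Finset.univ.erase j, letterWeight (α i) (β i)) * letterWeight false (β j) else 0)
        + if β (σ.symm j) = false then
          (∏ i ∈ Finset.univ.erase (σ.symm j), letterWeight (α i) (β i))
            * letterWeight (α (σ.symm j)) true else 0 := by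
    intro j
    have hj : α j = β (σ.symm j) := by rw [← h, Equiv.apply_symm_apply]
    cases hα : α j with
    | true =>
      -- The arc into j is already an ascent, so its tail keeps its type and only the factor at j
      -- changes. For a descent below, only the tail changes.
      have hβ : ∀ i, (decide (σ i = j) || β i) = β i := by
        intro i
        by_cases hi : σ i = j
        · have : β i = true := by rw [← h, hi, hα]
          simp [this]
        · simp [hi]
      rw [← hj, hα]
      simp only [hβ, if_true, Bool.true_eq_false, if_false, add_zero]
      rw [← Finset.prod_erase_mul _ _ (Finset.mem_univ j)]
      congr 1
      · refine Finset.prod_congr rfl fun i hi => ?_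
        simp [Finset.ne_of_mem_erase hi]
      · simp
    | false =>
      have hα' : ∀ i, (!decide (i = j) && α i) = α i := by
        intro i
        by_cases hi : i = j
        · simp [hi, hα]
        · simp [hi]
      rw [← hj, hα]
      simp only [hα', if_true, Bool.false_eq_true, if_false, zero_add]
      rw [← Finset.prod_erase_mul _ _ (Finset.mem_univ (σ.symm j))]
      congr 1
      · refine Finset.prod_congr rfl fun i hi => ?_
        have : σ i ≠ j := fun hij => Finset.ne_of_mem_erase hi (by rw [← hij]; simp)
        simp [this]
      · simp
  -- Reindexing the descending arcs by their tails puts both contributions to one letter under the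
  -- same index.
  rw [derivation_prod, Finset.sum_congr rfl fun j _ => hterm j, Finset.sum_add_distrib,
    Equiv.sum_comp σ.symm fun i => if β i = false then
      (∏ k ∈ Finset.univ.erase i, letterWeight (A := A) (α k) (β k)) * letterWeight (α i) true
      else 0, ← Finset.sum_add_distrib]
  refine Finset.sum_congr rfl fun i _ => ?_
  rw [insDer_letterWeight, mul_add, mul_ite, mul_ite, mul_zero]

/-! ### Iterating the insertion operator -/

theorem insDer_iterate (x : A) (P : MvPolynomial (Fin 3) A) (h : ℕ) :
    (insDer A)^[h] (C x * X 1 * P + X 2 * insDer A P)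
      = X 2 * (insDer A)^[h + 1] P + (C x * X 1 + (h : MvPolynomial (Fin 3) A) * (X 0 + X 1))
        * (insDer A)^[h] P
        + ((h : MvPolynomial (Fin 3) A) * (C x + (h : MvPolynomial (Fin 3) A) - 1))
          * (insDer A)^[h - 1] P := by
  induction h with
  | zero => simp [add_comm]
  | succ h ih =>
    rw [Function.iterate_succ_apply', ih]
    have hC : insDer A (C x) = 0 := derivation_C _ _
    simp only [Derivation.map_add, Derivation.map_sub, Derivation.leibniz, smul_eq_mul, hC,
      insDer_X0, insDer_X1, insDer_X2, Derivation.map_natCast, Derivation.map_one_eq_zero,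
      ← Function.iterate_succ_apply', Nat.add_sub_cancel]
    -- Differentiating the last term yields the exponent (h - 1) + 1, which differs from h when h =
    -- 0; there its coefficient vanishes.
    rcases h with _ | h
    · simp
      ring
    · simp only [Nat.succ_eq_add_one, Nat.add_sub_cancel]
      push_cast
      ring

/-- The variables r and u must survive until all derivatives are taken; only then are they set to 1.
-/
theorem eval_insDer_iterate (q x : A) (P : ℕ → MvPolynomial (Fin 3) A) (h0 : P 0 = 1)
    (hP : ∀ n, P (n + 1) = C x * X 1 * P n + X 2 * insDer A (P n)) (n h : ℕ) :
    eval ![q, 1, 1] ((insDer A)^[h] (P n))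
      = tridiag (fun h : ℕ => (h : A) * (1 + q) + x)
          (fun h : ℕ => ((h : A) + 1) * ((h : A) + x)) n h := by
  induction n generalizing h with
  | zero =>
    cases h with
    | zero => simp [h0, tridiag]
    | succ h =>
      rw [h0, Function.iterate_succ_apply, Derivation.map_one_eq_zero, tridiag,
        Function.iterate_fixed (Derivation.map_zero (insDer A)), map_zero]
  | succ n ih =>
    rw [hP, insDer_iterate]
    cases h with
    | zero =>
      rw [tridiag, ← ih 1, ← ih 0]
      simp
    | succ h =>
      rw [tridiag, ← ih (h + 2), ← ih (h + 1), ← ih h]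
      simp
      ring

end Weight

/-! ### Inserting a new maximum into the cycles of a permutation -/

section Insertion

variable {n : ℕ}

/-- The equivalence that inserts the new maximum before a given letter of a permutation
(in its cycle), or as a new fixed point. -/
def insertMax (n : ℕ) : Option (Fin n) × Equiv.Perm (Fin n) ≃ Equiv.Perm (Fin (n + 1)) :=
  Equiv.Perm.decomposeOption.symm.trans finSuccEquivLast.symm.permCongr

theorem insertMax_apply (p : Option (Fin n) × Equiv.Perm (Fin n)) (y : Fin (n + 1)) :
    insertMax n p y = finSuccEquivLast.symm
      (Equiv.swap none p.1 (Option.map p.2 (finSuccEquivLast y))) := by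
  simp [insertMax, Equiv.permCongr_apply]

theorem insertMax_none_castSucc (σ : Equiv.Perm (Fin n)) (i : Fin n) :
    insertMax n (none, σ) i.castSucc = (σ i).castSucc := by
  simp [insertMax_apply]

theorem insertMax_none_last (σ : Equiv.Perm (Fin n)) :
    insertMax n (none, σ) (Fin.last n) = Fin.last n := by
  simp [insertMax_apply]

theorem insertMax_some_castSucc (j : Fin n) (σ : Equiv.Perm (Fin n)) (i : Fin n) :
    insertMax n (some j, σ) i.castSucc = if σ i = j then Fin.last n else (σ i).castSucc := by
  rw [insertMax_apply]
  split_ifs with h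
  · simp [h]
  · simp [Equiv.swap_apply_of_ne_of_ne, h]

theorem insertMax_some_last (j : Fin n) (σ : Equiv.Perm (Fin n)) :
    insertMax n (some j, σ) (Fin.last n) = j.castSucc := by
  simp [insertMax_apply]

theorem insertMax_none_symm_castSucc (σ : Equiv.Perm (Fin n)) (i : Fin n) :
    (insertMax n (none, σ)).symm i.castSucc = (σ.symm i).castSucc := by
  rw [Equiv.symm_apply_eq, insertMax_none_castSucc, Equiv.apply_symm_apply]

theorem insertMax_none_symm_last (σ : Equiv.Perm (Fin n)) :
    (insertMax n (none, σ)).symm (Fin.last n) = Fin.last n := by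
  rw [Equiv.symm_apply_eq, insertMax_none_last]

theorem insertMax_some_symm_castSucc (j : Fin n) (σ : Equiv.Perm (Fin n)) (i : Fin n) :
    (insertMax n (some j, σ)).symm i.castSucc
      = if i = j then Fin.last n else (σ.symm i).castSucc := by
  rw [Equiv.symm_apply_eq]
  split_ifs with h
  · rw [insertMax_some_last, h]
  · rw [insertMax_some_castSucc, Equiv.apply_symm_apply, if_neg h]

theorem insertMax_some_symm_last (j : Fin n) (σ : Equiv.Perm (Fin n)) :
    (insertMax n (some j, σ)).symm (Fin.last n) = (σ.symm j).castSucc := by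
  rw [Equiv.symm_apply_eq, insertMax_some_castSucc, Equiv.apply_symm_apply, if_pos rfl]

open Classical in
/-- The product of the weights of the letters of `π`. -/
def permWeight (A : Type*) [CommRing A] (π : Equiv.Perm (Fin n)) : MvPolynomial (Fin 3) A :=
  ∏ i, letterWeight (decide (π.symm i < i)) (decide (i < π i))

variable {A : Type*} [CommRing A]

theorem permWeight_insertMax_none (σ : Equiv.Perm (Fin n)) :
    permWeight A (insertMax n (none, σ)) = X 1 * permWeight A σ := by
  rw [permWeight, Fin.prod_univ_castSucc, mul_comm, permWeight]
  simp only [insertMax_none_castSucc, insertMax_none_last, insertMax_none_symm_castSucc,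
    insertMax_none_symm_last, Fin.castSucc_lt_castSucc_iff, lt_irrefl, decide_false, letterWeight]

/-- The new maximum is a peak; j loses an ascent into it and σ⁻¹ j gains an ascent out of it. -/
theorem permWeight_insertMax_some (j : Fin n) (σ : Equiv.Perm (Fin n)) :
    permWeight A (insertMax n (some j, σ)) = X 2 *
      ∏ i, letterWeight (!decide (i = j) && decide (σ.symm i < i))
        (decide (σ i = j) || decide (i < σ i)) := by
  rw [permWeight, Fin.prod_univ_castSucc, mul_comm]
  congr 1
  · simp [insertMax_some_last, insertMax_some_symm_last, letterWeight, Fin.castSucc_lt_last,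
      (Fin.castSucc_lt_last _).not_gt]
  · refine Finset.prod_congr rfl fun i _ => ?_
    rw [insertMax_some_castSucc, insertMax_some_symm_castSucc]
    congr 1
    · split_ifs with h <;> simp [h, (Fin.castSucc_lt_last _).not_gt]
    · split_ifs with h <;> simp [h, Fin.castSucc_lt_last]

theorem sum_permWeight_insertMax_some (σ : Equiv.Perm (Fin n)) :
    ∑ j, permWeight A (insertMax n (some j, σ)) = X 2 * insDer A (permWeight A σ) := by
  simp only [permWeight_insertMax_some, ← Finset.mul_sum]
  rw [permWeight, ← sum_prod_letterWeight σ]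
  · simp

/-! ### The number of cycles -/

open Classical in
theorem cyc_eq_card (π : Equiv.Perm (Fin n)) :
    cyc π = ∑ i, if IsCycleMin π i then 1 else 0 := by
  rw [Finset.sum_boole, cyc, stdCycleForm, List.length_map, List.filter_reverse,
    List.length_reverse, Nat.cast_id]
  rw [← List.toFinset_card_of_nodup ((List.nodup_finRange n).filter _)]
  congr 1
  ext i
  simp

/-- A map that sends each step of `f` to a step of `g` or to a stationary step preserves cycles. -/
theorem sameCycle_of_map {α β : Type*} [Finite α] {f : Equiv.Perm α} {g : Equiv.Perm β}
    (φ : α → β) (h : ∀ a, g.SameCycle (φ a) (φ (f a))) {a b : α} (hab : f.SameCycle a b) :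
    g.SameCycle (φ a) (φ b) := by
  obtain ⟨k, rfl⟩ := hab.exists_nat_pow_eq
  clear hab
  induction k with
  | zero => exact .rfl
  | succ k ih =>
    rw [pow_succ', Equiv.Perm.mul_apply]
    exact ih.trans (h _)

theorem sameCycle_insertMax_none (σ : Equiv.Perm (Fin n)) (a b : Fin n) :
    (insertMax n (none, σ)).SameCycle a.castSucc b.castSucc ↔ σ.SameCycle a b := by
  constructor
  · intro h
    have := sameCycle_of_map (g := σ) (fun y => (finSuccEquivLast y).getD a) (fun y => ?_) h
    · simpa using this
    · induction y using Fin.lastCases with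
      | last => simp [insertMax_none_last, Equiv.Perm.SameCycle.rfl]
      | cast i => simp [insertMax_none_castSucc, Equiv.Perm.SameCycle.rfl]
  · refine sameCycle_of_map Fin.castSucc fun i => ?_
    rw [← insertMax_none_castSucc]
    simp [Equiv.Perm.SameCycle.rfl]

theorem sameCycle_insertMax_some (j : Fin n) (σ : Equiv.Perm (Fin n)) (a b : Fin n) :
    (insertMax n (some j, σ)).SameCycle a.castSucc b.castSucc ↔ σ.SameCycle a b := by
  constructor
  · intro h
    -- Contract the new maximum onto its successor j: the arc σ⁻¹ j → max becomes a step of σ, and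
    -- max → j becomes stationary.
    have := sameCycle_of_map (g := σ) (fun y => (finSuccEquivLast y).getD j) (fun y => ?_) h
    · simpa using this
    · induction y using Fin.lastCases with
      | last => simp [insertMax_some_last, Equiv.Perm.SameCycle.rfl]
      | cast i =>
        rw [insertMax_some_castSucc]
        split_ifs with h
        · simp [← h, Equiv.Perm.SameCycle.rfl]
        · simp [Equiv.Perm.SameCycle.rfl]
  · refine sameCycle_of_map Fin.castSucc fun i => ?_
    by_cases h : σ i = j
    · have : (σ i).castSucc = insertMax n (some j, σ) (insertMax n (some j, σ) i.castSucc) := by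
        rw [insertMax_some_castSucc, if_pos h, insertMax_some_last, h]
      rw [this]
      simp [Equiv.Perm.SameCycle.rfl]
    · have : (σ i).castSucc = insertMax n (some j, σ) i.castSucc := by
        rw [insertMax_some_castSucc, if_neg h]
      rw [this]
      simp [Equiv.Perm.SameCycle.rfl]

theorem isCycleMin_castSucc {π : Equiv.Perm (Fin (n + 1))} {σ : Equiv.Perm (Fin n)}
    (h : ∀ a b : Fin n, π.SameCycle a.castSucc b.castSucc ↔ σ.SameCycle a b) (i : Fin n) :
    IsCycleMin π i.castSucc ↔ IsCycleMin σ i := by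
  refine ⟨fun H j hj => ?_, fun H j hj => ?_⟩
  · simpa using H j.castSucc ((h _ _).2 hj)
  · induction j using Fin.lastCases with
    | last => exact Fin.le_last _
    | cast j => simpa using H j ((h _ _).1 hj)

theorem cyc_insertMax_none (σ : Equiv.Perm (Fin n)) :
    cyc (insertMax n (none, σ)) = cyc σ + 1 := by
  classical
  rw [cyc_eq_card, Fin.sum_univ_castSucc, cyc_eq_card]
  simp only [isCycleMin_castSucc (sameCycle_insertMax_none σ)]
  congr 1
  rw [if_pos]
  intro j hj
  exact (hj.eq_of_left (insertMax_none_last σ)).le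

theorem cyc_insertMax_some (j : Fin n) (σ : Equiv.Perm (Fin n)) :
    cyc (insertMax n (some j, σ)) = cyc σ := by
  classical
  rw [cyc_eq_card, Fin.sum_univ_castSucc, cyc_eq_card]
  simp only [isCycleMin_castSucc (sameCycle_insertMax_some j σ)]
  rw [if_neg, add_zero]
  intro H
  have := H j.castSucc (by rw [← insertMax_some_last j σ]; simp [Equiv.Perm.SameCycle.rfl])
  exact this.not_gt (Fin.castSucc_lt_last j)

/-! ### The enumerator of permutations by letter types and cycles -/

/-- The sum of the weights of the permutations of `Fin n`, each cycle having weight `x`. -/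
def permEnum (x : A) (n : ℕ) : MvPolynomial (Fin 3) A :=
  ∑ π : Equiv.Perm (Fin n), C x ^ cyc π * permWeight A π

theorem permEnum_zero (x : A) : permEnum x 0 = 1 := by
  simp [permEnum, permWeight, cyc_eq_card]

theorem permEnum_succ (x : A) (n : ℕ) :
    permEnum x (n + 1) = C x * X 1 * permEnum x n + X 2 * insDer A (permEnum x n) := by
  have hC : ∀ k, insDer A (C x ^ k) = 0 := fun k => by rw [← C_pow]; exact derivation_C _ _
  simp only [permEnum]
  rw [← (insertMax n).sum_comp, Fintype.sum_prod_type_right, map_sum, Finset.mul_sum,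
    Finset.mul_sum, ← Finset.sum_add_distrib]
  refine Finset.sum_congr rfl fun σ _ => ?_
  simp only [Fintype.sum_option, cyc_insertMax_none, cyc_insertMax_some,
    permWeight_insertMax_none, ← Finset.mul_sum, sum_permWeight_insertMax_some,
    Derivation.leibniz, hC, smul_eq_mul]
  ring

open Classical in
theorem eval_permWeight (q : A) (π : Equiv.Perm (Fin n)) :
    eval ![q, 1, 1] (permWeight A π)
      = q ^ (Finset.univ.filter fun i => π.symm i < i ∧ i < π i).card := by
  rw [permWeight, map_prod, ← Finset.prod_const, Finset.prod_filter]
  refine Finset.prod_congr rfl fun i _ => ?_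
  by_cases h1 : π.symm i < i <;> by_cases h2 : i < π i <;> simp [h1, h2, letterWeight]

open Classical in
theorem sum_pow_eq_tridiag (q x : A) (n : ℕ) :
    ∑ π : Equiv.Perm (Fin n),
        q ^ (Finset.univ.filter fun i => π.symm i < i ∧ i < π i).card * x ^ cyc π
      = tridiag (fun h : ℕ => (h : A) * (1 + q) + x)
          (fun h : ℕ => ((h : A) + 1) * ((h : A) + x)) n 0 := by
  rw [← eval_insDer_iterate q x (permEnum x) (permEnum_zero x) (permEnum_succ x),
    Function.iterate_zero_apply, permEnum, map_sum]
  refine Finset.sum_congr rfl fun π _ => ?_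
  rw [map_mul, eval_permWeight, map_pow, eval_C, mul_comm]

end Insertion

end CycPat

namespace CycPat

/-! ### Lists of blocks -/

section Blocks

variable {α : Type*} [LT α]

/-- The first letter of each later block is smaller than all letters of the earlier blocks. -/
def HeadsDecrease (L : List (List α)) : Prop :=
  L.Pairwise fun B B' => ∀ a ∈ B, ∀ b, B'.head? = some b → b < a

/-- Separates the two kinds of adjacency in the word: inside a block, or across a boundary, where
the next letter is a head and hence a descent. -/
theorem getElem?_flatten_block {L : List (List α)} (hne : ∀ B ∈ L, B ≠ [])
    (hL : HeadsDecrease L) {j : ℕ} {a : α} (h : L.flatten[j]? = some a) :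
    ∃ B ∈ L, ∃ k, B[k]? = some a ∧
      (∀ b, B[k + 1]? = some b →
        (¬ ∃ m, j + 1 = (L.take m).flatten.length) ∧ L.flatten[j + 1]? = some b) ∧
      (B[k + 1]? = none → ∀ b, L.flatten[j + 1]? = some b → b < a) := by
  induction L generalizing j with
  | nil => simp at h
  | cons B L ih =>
    rw [HeadsDecrease, List.pairwise_cons] at hL
    rw [List.flatten_cons, List.getElem?_append] at h
    split_ifs at h with hj
    · refine ⟨B, by simp, j, h, fun b hb => ?_, fun hb b hb' => ?_⟩
      · have hj1 : j + 1 < B.length := (List.getElem?_eq_some_iff.1 hb).1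
        refine ⟨?_, by rw [List.flatten_cons, List.getElem?_append, if_pos hj1, hb]⟩
        rintro ⟨m, hm⟩
        cases m with
        | zero => simp at hm
        | succ m =>
          rw [List.take_succ_cons, List.flatten_cons, List.length_append] at hm
          omega
      · have hj1 : j + 1 = B.length := by
          rw [List.getElem?_eq_none_iff] at hb
          omega
        rw [List.flatten_cons, List.getElem?_append, if_neg (by omega), hj1, Nat.sub_self] at hb'
        cases L with
        | nil => simp at hb'
        | cons B' L' =>
          have hB' : B' ≠ [] := hne B' (by simp)
          refine hL.1 B' (by simp) a (List.mem_of_getElem? h) b ?_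
          obtain ⟨x, t, rfl⟩ := List.exists_cons_of_ne_nil hB'
          simpa using hb'
    · obtain ⟨C, hC, k, hk, h1, h2⟩ := ih (fun C hC => hne C (by simp [hC])) hL.2 h
      have hstep : (B :: L).flatten[j + 1]? = L.flatten[j - B.length + 1]? := by
        rw [List.flatten_cons, List.getElem?_append, if_neg (by omega)]
        congr 1
        omega
      refine ⟨C, by simp [hC], k, hk, fun b hb => ⟨?_, hstep ▸ (h1 b hb).2⟩,
        fun hb b hb' => h2 hb b (hstep ▸ hb')⟩
      rintro ⟨m, hm⟩
      cases m with
      | zero => simp at hm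
      | succ m =>
        rw [List.take_succ_cons, List.flatten_cons, List.length_append] at hm
        exact (h1 b hb).1 ⟨m, by omega⟩

end Blocks

section BlockUniqueness

variable {α : Type*} [Preorder α]

/-- A first letter of `as` would be the head of the block after B, hence below the head of B, yet
also a later letter of a block with that same head as strict minimum. -/
theorem eq_nil_of_block_append {B as : List α} {L : List (List α)} {u : List α}
    (hB : B ≠ []) (hBas : ∃ h t, B ++ as = h :: t ∧ ∀ x ∈ t, h < x)
    (hne : ∀ C ∈ L, C ≠ []) (hL : HeadsDecrease (B :: L)) (h : L.flatten = as ++ u) :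
    as = [] := by
  obtain ⟨y, s, rfl⟩ := List.exists_cons_of_ne_nil hB
  obtain ⟨y', t, ht, hlt⟩ := hBas
  rw [List.cons_append, List.cons.injEq] at ht
  obtain ⟨rfl, rfl⟩ := ht
  cases as with
  | nil => rfl
  | cons x xs =>
    exfalso
    cases L with
    | nil => simp at h
    | cons C L =>
      obtain ⟨c, C', rfl⟩ := List.exists_cons_of_ne_nil (hne C (by simp))
      simp only [List.flatten_cons, List.cons_append, List.cons.injEq] at h
      have h1 : c < y := (List.pairwise_cons.1 hL).1 (c :: C') (by simp) y (by simp) c (by simp)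
      have h2 : y < x := hlt x (by simp)
      rw [← h.1] at h2
      exact lt_asymm h1 h2

/-- A word has at most one decomposition into blocks that start with their smallest letter, the
first letters decreasing. -/
theorem eq_of_flatten_eq {L L' : List (List α)}
    (hmin : ∀ B ∈ L, ∃ h t, B = h :: t ∧ ∀ x ∈ t, h < x)
    (hmin' : ∀ B ∈ L', ∃ h t, B = h :: t ∧ ∀ x ∈ t, h < x)
    (hL : HeadsDecrease L) (hL' : HeadsDecrease L') (h : L.flatten = L'.flatten) : L = L' := by
  have hne : ∀ {M : List (List α)}, (∀ B ∈ M, ∃ h t, B = h :: t ∧ ∀ x ∈ t, h < x) →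
      ∀ B ∈ M, B ≠ [] := fun hM B hB => by
    obtain ⟨x, t, rfl, -⟩ := hM B hB
    simp
  induction L generalizing L' with
  | nil =>
    cases L' with
    | nil => rfl
    | cons B' L' =>
      obtain ⟨x, t, rfl, -⟩ := hmin' B' (by simp)
      simp at h
  | cons B L ih =>
    cases L' with
    | nil =>
      obtain ⟨x, t, rfl, -⟩ := hmin B (by simp)
      simp at h
    | cons B' L' =>
      have hB : B = B' := by
        rw [List.flatten_cons, List.flatten_cons, List.append_eq_append_iff] at h
        rcases h with ⟨as, h1, h2⟩ | ⟨as, h1, h2⟩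
        · have := eq_nil_of_block_append (hne hmin B (by simp)) (h1 ▸ hmin' B' (by simp))
            (fun C hC => hne hmin C (by simp [hC])) hL h2
          simp [h1, this]
        · have := eq_nil_of_block_append (hne hmin' B' (by simp)) (h1 ▸ hmin B (by simp))
            (fun C hC => hne hmin' C (by simp [hC])) hL' h2
          simp [h1, this]
      subst hB
      rw [ih (fun C hC => hmin C (by simp [hC])) (fun C hC => hmin' C (by simp [hC]))
        (List.pairwise_cons.1 hL).2 (List.pairwise_cons.1 hL').2 (List.append_cancel_left h)]

end BlockUniqueness

/-! ### The standard cycle form -/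

section StdCycleForm

variable {n : ℕ} (π : Equiv.Perm (Fin n))

theorem minimalPeriod_pos (i : Fin n) : 0 < Function.minimalPeriod π i :=
  Function.minimalPeriod_pos_of_mem_periodicPts
    (Function.Injective.mem_periodicPts π.injective i)

theorem head?_cycleWord (i : Fin n) : (cycleWord π i).head? = some i := by
  rw [List.head?_eq_getElem?, cycleWord, List.getElem?_iterate _ _ _ _ (minimalPeriod_pos π i)]
  rfl

theorem nodup_cycleWord (i : Fin n) : (cycleWord π i).Nodup := by
  rw [cycleWord, ← List.range_map_iterate]
  refine List.Nodup.map_on (fun a ha b hb h => ?_) List.nodup_range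
  exact Function.iterate_injOn_Iio_minimalPeriod (List.mem_range.1 ha) (List.mem_range.1 hb) h

theorem mem_cycleWord {i a : Fin n} : a ∈ cycleWord π i ↔ π.SameCycle i a := by
  rw [cycleWord, List.mem_iterate]
  constructor
  · rintro ⟨m, -, rfl⟩
    exact ⟨m, by rw [zpow_natCast, Equiv.Perm.iterate_eq_pow]⟩
  · intro h
    obtain ⟨m, rfl⟩ := h.exists_nat_pow_eq
    refine ⟨m % Function.minimalPeriod π i, Nat.mod_lt _ (minimalPeriod_pos π i), ?_⟩
    rw [Function.iterate_mod_minimalPeriod_eq, Equiv.Perm.iterate_eq_pow]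

theorem getElem?_cycleWord {i a : Fin n} {k : ℕ} (h : (cycleWord π i)[k]? = some a) :
    a = π^[k] i := by
  have hk : k < Function.minimalPeriod π i := by
    have := (List.getElem?_eq_some_iff.1 h).1
    rwa [cycleWord, List.length_iterate] at this
  rw [cycleWord, List.getElem?_iterate _ _ _ _ hk] at h
  exact (Option.some.inj h).symm

theorem getElem?_cycleWord_succ {i a b : Fin n} {k : ℕ} (ha : (cycleWord π i)[k]? = some a)
    (hb : (cycleWord π i)[k + 1]? = some b) : b = π a := by
  rw [getElem?_cycleWord π hb, getElem?_cycleWord π ha, Function.iterate_succ_apply']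

theorem getElem?_cycleWord_last {i a : Fin n} {k : ℕ} (ha : (cycleWord π i)[k]? = some a)
    (hb : (cycleWord π i)[k + 1]? = none) : π a = i := by
  have h1 := (List.getElem?_eq_some_iff.1 ha).1
  rw [List.getElem?_eq_none_iff] at hb
  rw [cycleWord, List.length_iterate] at h1 hb
  rw [getElem?_cycleWord π ha, ← Function.iterate_succ_apply' (⇑π),
    show k.succ = Function.minimalPeriod π i by omega, Function.iterate_minimalPeriod]

theorem mem_stdCycleForm {B : List (Fin n)} :
    B ∈ stdCycleForm π ↔ ∃ i, IsCycleMin π i ∧ cycleWord π i = B := by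
  simp [stdCycleForm]

theorem exists_cons_of_mem_stdCycleForm {B : List (Fin n)} (hB : B ∈ stdCycleForm π) :
    ∃ h t, B = h :: t ∧ ∀ x ∈ t, h < x := by
  obtain ⟨i, hi, rfl⟩ := (mem_stdCycleForm π).1 hB
  have hh := head?_cycleWord π i
  have hn := nodup_cycleWord π i
  have hm : ∀ x ∈ cycleWord π i, i ≤ x := fun x hx => hi x ((mem_cycleWord π).1 hx)
  cases hw : cycleWord π i with
  | nil => simp [hw] at hh
  | cons y t =>
    rw [hw] at hh hn hm
    obtain rfl : y = i := by simpa using hh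
    refine ⟨y, t, rfl, fun x hx => lt_of_le_of_ne (hm x (by simp [hx])) ?_⟩
    rintro rfl
    exact (List.nodup_cons.1 hn).1 hx

theorem ne_nil_of_mem_stdCycleForm {B : List (Fin n)} (hB : B ∈ stdCycleForm π) : B ≠ [] := by
  obtain ⟨h, t, rfl, -⟩ := exists_cons_of_mem_stdCycleForm π hB
  simp

theorem pairwise_stdCycleForm {R : List (Fin n) → List (Fin n) → Prop}
    (hR : ∀ i j, IsCycleMin π i → IsCycleMin π j → j < i → R (cycleWord π i) (cycleWord π j)) :
    (stdCycleForm π).Pairwise R := by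
  rw [stdCycleForm, List.pairwise_map, List.pairwise_filter, List.pairwise_reverse]
  refine (List.pairwise_lt_finRange n).imp fun h hi hj => ?_
  exact hR _ _ (by simpa using hi) (by simpa using hj) h

theorem headsDecrease_stdCycleForm : HeadsDecrease (stdCycleForm π) := by
  refine pairwise_stdCycleForm π fun i j hi _ hij a ha b hb => ?_
  rw [head?_cycleWord, Option.some.injEq] at hb
  exact hb ▸ hij.trans_le (hi a ((mem_cycleWord π).1 ha))

theorem nodup_psi : (psi π).Nodup := by
  rw [psi, List.nodup_flatten]
  refine ⟨fun B hB => ?_, pairwise_stdCycleForm π fun i j hi hj hij a hai haj => ?_⟩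
  · obtain ⟨i, -, rfl⟩ := (mem_stdCycleForm π).1 hB
    exact nodup_cycleWord π i
  · rw [mem_cycleWord] at hai haj
    exact (hi j (hai.trans haj.symm)).not_gt hij

theorem exists_block (a : Fin n) : ∃ i, IsCycleMin π i ∧ a ∈ cycleWord π i := by
  obtain ⟨i, hi, hmin⟩ := wellFounded_lt.has_min {j | π.SameCycle a j} ⟨a, .rfl⟩
  exact ⟨i, fun j hj => not_lt.1 (hmin j (Equiv.Perm.SameCycle.trans hi hj)),
    (mem_cycleWord π).2 (Equiv.Perm.SameCycle.symm hi)⟩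

theorem mem_psi (a : Fin n) : a ∈ psi π := by
  obtain ⟨i, hi, ha⟩ := exists_block π a
  exact List.mem_flatten.2 ⟨_, (mem_stdCycleForm π).2 ⟨i, hi, rfl⟩, ha⟩

theorem length_psi : (psi π).length = n := by
  rw [← List.toFinset_card_of_nodup (nodup_psi π),
    Finset.eq_univ_iff_forall.2 fun a => List.mem_toFinset.2 (mem_psi π a), Finset.card_fin]

/-- The image of a letter is read off its block: the next letter, or the head if the letter is last.
-/
theorem stdCycleForm_injective :
    Function.Injective (stdCycleForm : Equiv.Perm (Fin n) → List (List (Fin n))) := by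
  intro π τ h
  ext1 a
  obtain ⟨i, hi, ha⟩ := exists_block π a
  have hB := (mem_stdCycleForm π).2 ⟨i, hi, rfl⟩
  rw [h, mem_stdCycleForm] at hB
  obtain ⟨j, -, hj⟩ := hB
  obtain ⟨k, hk⟩ := List.getElem?_of_mem ha
  have hk' := hk
  rw [← hj] at hk'
  cases hb : (cycleWord π i)[k + 1]? with
  | some b =>
    have hb' := hb
    rw [← hj] at hb'
    rw [← getElem?_cycleWord_succ π hk hb, ← getElem?_cycleWord_succ τ hk' hb']
  | none =>
    have hb' := hb
    rw [← hj] at hb'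
    rw [getElem?_cycleWord_last π hk hb, getElem?_cycleWord_last τ hk' hb']
    have := congrArg List.head? hj
    rw [head?_cycleWord, head?_cycleWord, Option.some.injEq] at this
    exact this.symm

theorem psi_injective : Function.Injective (psi : Equiv.Perm (Fin n) → List (Fin n)) := by
  intro π τ h
  exact stdCycleForm_injective (eq_of_flatten_eq (fun _ => exists_cons_of_mem_stdCycleForm π)
    (fun _ => exists_cons_of_mem_stdCycleForm τ) (headsDecrease_stdCycleForm π)
    (headsDecrease_stdCycleForm τ) h)

/-- The last letter of a block maps to the minimum of its cycle, so a letter with a < π a is not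
last. -/
theorem getElem?_psi_of_lt_apply {j : ℕ} {a : Fin n} (h : (psi π)[j]? = some a) (ha : a < π a) :
    ¬ IsCycleEnd π j ∧ (psi π)[j + 1]? = some (π a) := by
  obtain ⟨B, hB, k, hk, h1, -⟩ := getElem?_flatten_block
    (fun _ => ne_nil_of_mem_stdCycleForm π) (headsDecrease_stdCycleForm π) h
  obtain ⟨i, hi, rfl⟩ := (mem_stdCycleForm π).1 hB
  cases hb : (cycleWord π i)[k + 1]? with
  | none =>
    rw [getElem?_cycleWord_last π hk hb] at ha
    exact absurd (hi a ((mem_cycleWord π).1 (List.mem_of_getElem? hk))) ha.not_ge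
  | some b =>
    obtain rfl := getElem?_cycleWord_succ π hk hb
    exact h1 _ hb

theorem getElem?_psi_of_lt_next {j : ℕ} {a b : Fin n} (h : (psi π)[j]? = some a)
    (hb : (psi π)[j + 1]? = some b) (hab : a < b) : ¬ IsCycleEnd π j ∧ b = π a := by
  obtain ⟨B, hB, k, hk, h1, h2⟩ := getElem?_flatten_block
    (fun _ => ne_nil_of_mem_stdCycleForm π) (headsDecrease_stdCycleForm π) h
  obtain ⟨i, hi, rfl⟩ := (mem_stdCycleForm π).1 hB
  cases hc : (cycleWord π i)[k + 1]? with
  | none => exact absurd (h2 hc b hb) hab.not_gt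
  | some c =>
    obtain rfl := getElem?_cycleWord_succ π hk hc
    refine ⟨(h1 _ hc).1, Option.some.inj ?_⟩
    rw [← hb]
    exact (h1 _ hc).2

/-! ### Occurrences of 123 -/

theorem occurs123_iff {w : List (Fin n)} {i : ℕ} :
    Occurs123 w i ↔ ∃ a b c, w[i]? = some a ∧ w[i + 1]? = some b ∧ w[i + 2]? = some c ∧
      a < b ∧ b < c := by
  constructor
  · rintro ⟨h, h1, h2⟩
    exact ⟨w[i], w[i + 1], w[i + 2], by simp, by simp, by simp, h1, h2⟩
  · rintro ⟨a, b, c, ha, hb, hc, hab, hbc⟩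
    obtain ⟨_, rfl⟩ := List.getElem?_eq_some_iff.1 ha
    obtain ⟨_, rfl⟩ := List.getElem?_eq_some_iff.1 hb
    obtain ⟨h, rfl⟩ := List.getElem?_eq_some_iff.1 hc
    exact ⟨h, hab, hbc⟩

theorem occurs123_psi_iff {i : ℕ} :
    Occurs123 (psi π) i ↔ ∃ a, (psi π)[i]? = some a ∧ a < π a ∧ π a < π (π a) := by
  rw [occurs123_iff]
  constructor
  · rintro ⟨a, b, c, ha, hb, hc, hab, hbc⟩
    obtain rfl := (getElem?_psi_of_lt_next π ha hb hab).2
    obtain rfl := (getElem?_psi_of_lt_next π hb hc hbc).2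
    exact ⟨a, ha, hab, hbc⟩
  · rintro ⟨a, ha, h1, h2⟩
    have hb := (getElem?_psi_of_lt_apply π ha h1).2
    exact ⟨a, π a, π (π a), ha, hb, (getElem?_psi_of_lt_apply π hb h2).2, h1, h2⟩

open Classical in
theorem cocc123_eq : cocc123 π = ((Finset.range n).filter (fun i => Occurs123 (psi π) i)).card := by
  rw [cocc123]
  congr 1
  refine Finset.filter_congr fun i _ => and_iff_left_of_imp fun H => ?_
  obtain ⟨a, ha, h1, h2⟩ := (occurs123_psi_iff π).1 H
  have := getElem?_psi_of_lt_apply π ha h1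
  exact ⟨this.1, (getElem?_psi_of_lt_apply π this.2 h2).1⟩

open Classical in
theorem cocc123_eq_card :
    cocc123 π = (Finset.univ.filter fun i => π.symm i < i ∧ i < π i).card := by
  rw [cocc123_eq]
  have hget : ∀ i ∈ (Finset.range n).filter (fun i => Occurs123 (psi π) i), i < (psi π).length :=
    fun i hi => by
      rw [length_psi]
      exact Finset.mem_range.1 (Finset.mem_filter.1 hi).1
  -- An occurrence is recorded by its middle letter, which is the double ascent.
  refine Finset.card_bij (fun i hi => π ((psi π)[i]'(hget i hi))) ?_ ?_ ?_
  · intro i hi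
    obtain ⟨a, ha, h⟩ := (occurs123_psi_iff π).1 (Finset.mem_filter.1 hi).2
    obtain ⟨_, rfl⟩ := List.getElem?_eq_some_iff.1 ha
    simpa using h
  · intro i hi j hj hij
    exact (nodup_psi π).getElem_inj_iff.1 (π.injective hij)
  · intro b hb
    obtain ⟨i, hi⟩ := List.getElem?_of_mem (mem_psi π (π.symm b))
    obtain ⟨hlt, hi'⟩ := List.getElem?_eq_some_iff.1 hi
    refine ⟨i, Finset.mem_filter.2 ⟨Finset.mem_range.2 (length_psi π ▸ hlt),
      (occurs123_psi_iff π).2 ⟨_, hi, by simpa using hb⟩⟩, ?_⟩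
    rw [hi', Equiv.apply_symm_apply]

/-- The permutation whose one-line notation is `psi π`. -/
def psiPerm : Equiv.Perm (Fin n) :=
  Equiv.ofBijective (fun i => (psi π)[i]'(by rw [length_psi]; exact i.2))
    (Finite.injective_iff_bijective.1 fun _ _ h =>
      Fin.ext ((nodup_psi π).getElem_inj_iff.1 h))

theorem ofFn_psiPerm : List.ofFn (psiPerm π) = psi π := by
  refine List.ext_getElem (by simp [length_psi]) fun i h1 h2 => ?_
  simp [psiPerm]

theorem psiPerm_bijective :
    Function.Bijective (psiPerm : Equiv.Perm (Fin n) → Equiv.Perm (Fin n)) :=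
  Finite.injective_iff_bijective.1 fun π τ h => psi_injective (by
    rw [← ofFn_psiPerm, ← ofFn_psiPerm, h])

theorem occ123_psiPerm : occ123 (psiPerm π) = cocc123 π := by
  rw [cocc123_eq, occ123, ofFn_psiPerm]

end StdCycleForm

/-! ### The generating functions -/

section GeneratingFunctions

variable {A : Type*} [CommRing A]

theorem coeff_F123_eq_tridiag (q x : A) (n : ℕ) :
    PowerSeries.coeff n (F123 q x) = tridiag (fun h : ℕ => (h : A) * (1 + q) + x)
      (fun h : ℕ => ((h : A) + 1) * ((h : A) + x)) n 0 := by
  classical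
  rw [coeff_F123, ← sum_pow_eq_tridiag]
  simp only [cocc123_eq_card]

theorem F123_one_eq_G123 (q : A) : F123 q 1 = G123 q := by
  ext n
  rw [coeff_F123, coeff_G123, ← psiPerm_bijective.sum_comp fun π => q ^ occ123 π]
  simp [occ123_psiPerm]

end GeneratingFunctions

end CycPat

end

theorem mainTheorem2 {A : Type*} [CommRing A] (q x : A) :
    (∀ N S E F : ℕ → A,
      (∀ h : ℕ, E h + F h = (h : A) * (1 + q) + x) →
      (∀ h : ℕ, N h * S (h + 1) = ((h : A) + 1) * ((h : A) + x)) →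
      CycPat.F123 q x = CycPat.motzkinGF N S E F) ∧
    CycPat.HasJFraction (CycPat.F123 q x)
      (fun h : ℕ => (h : A) * (1 + q) + x)
      (fun h : ℕ => ((h : A) + 1) * ((h : A) + x)) ∧
    CycPat.F123 q 1 = CycPat.G123 q := by
  refine ⟨fun N S E F hb hc => ?_, CycPat.hasJFraction_of_coeff_eq_tridiag
    (CycPat.coeff_F123_eq_tridiag q x), CycPat.F123_one_eq_G123 q⟩
  ext n
  rw [CycPat.coeff_F123_eq_tridiag, CycPat.coeff_motzkinGF hb hc]
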